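/- All Hilbert spaces are finite-dimensional and complex, and $\mathrm{S}(\mathcal{H})$ denotes the set of density matrices on $\mathcal{H}$. For a unit vector $|\theta\rangle\in\mathcal{H}$ and $0\le m\le n$ let $$\mathcal{V}(\mathcal{H}^{\otimes n},|\theta\rangle^{\otimes m}):=\{\pi(|\theta\rangle^{\otimes m}\otimes|\Omega\rangle):\ \pi\in\mathcal{S}_n,\ |\Omega\rangle\in\mathcal{H}^{\otimes (n-m)}\},$$ where permutations $\pi\in\mathcal{S}_n$ act on $\mathcal{H}^{\otimes n}$ by permuting the tensor factors. Let $\sigma_A\in\mathrm{S}(\mathcal{H}_A)$ and let $0\le r\le n$ be integers. A density matrix $\rho_{A_1^n}\in\mathrm{S}(\mathcal{H}_A^{\otimes n})$ is called an $\binom{n}{r}$-almost-iid state in $\sigma_A$ if there exist a purification $|\theta\rangle_{AE}\in\mathcal{H}_A\otimes\mathcal{H}_E$ of $\sigma_A$, for some $\mathcal{H}_E$, and an extension $\rho_{A_1^nE_1^n}\in\mathrm{S}\big((\mathcal{H}_A\otimes\mathcal{H}_E)^{\otimes n}\big)$ of $\rho_{A_1^n}$ (that is, $\mathrm{tr}_{E_1^n}[\rho_{A_1^nE_1^n}]=\rho_{A_1^n}$)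 such that (i) $\rho_{A_1^nE_1^n}$ is invariant under permutations of the $n$ pairs $(A_i,E_i)$; (ii) $\mathrm{supp}(\rho_{A_1^nE_1^n}):=\ker(\rho_{A_1^nE_1^n})^\perp\subseteq\mathrm{span}\,\mathcal{V}\big((\mathcal{H}_A\otimes\mathcal{H}_E)^{\otimes n},|\theta\rangle_{AE}^{\otimes (n-r)}\big)$. **Proposition.** Let $n\ge 1$ and $0\le r,s\le n$ be integers, let $\sigma_A\in\mathrm{S}(\mathcal{H}_A)$, and let $\rho_{A_1^n}$ be an $\binom{n}{r}$-almost-iid state in $\sigma_A$. Then $$\big\|\mathrm{tr}_{n-s}[\rho_{A_1^n}]-\sigma_A^{\otimes s}\big\|_1\le 4\sqrt{\frac{rs}{n}},$$ where $\|\cdot\|_1$ is the trace norm and $\mathrm{tr}_{n-s}$ is the partial trace over the last $n-s$ of the $n$ subsystems. -/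

import Mathlib

/-! Finite-dimensional quantum systems in coordinates: the Hilbert space of a system `A` is
`EuclideanSpace ℂ A` for a finite type `A`, its `n`-fold tensor power is
`EuclideanSpace ℂ (Fin n → A)`, the space of the composite system `AE` is
`EuclideanSpace ℂ (A × E)`, and operators are complex matrices. -/

noncomputable section

namespace AlmostIID

open scoped ComplexOrder

/-- Density matrices: positive semidefinite matrices of trace one. -/
def IsDensity {X : Type*} [Fintype X] (ρ : Matrix X X ℂ) : Prop :=
  ρ.PosSemidef ∧ ρ.trace = 1

/-- The trace norm, i.e. the sum of the singular values. -/
def traceNorm {X : Type*} [Fintype X] [DecidableEq X] (M : Matrix X X ℂ) : ℝ :=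
  ∑ i ∈ Finset.range (Fintype.card X), (Matrix.toEuclideanLin M).singularValues i

/-- The support `ker(M)ᗮ` of an operator `M`. -/
def supp {X : Type*} [Fintype X] [DecidableEq X] (M : Matrix X X ℂ) :
    Submodule ℂ (EuclideanSpace ℂ X) :=
  (LinearMap.ker (Matrix.toEuclideanLin M))ᗮ

/-- The `s`-fold tensor power of an operator. -/
def tensorPow {A : Type*} (σ : Matrix A A ℂ) (s : ℕ) : Matrix (Fin s → A) (Fin s → A) ℂ :=
  Matrix.of fun x y => ∏ i, σ (x i) (y i)

/-- Joins a configuration of the first `s` of `n` systems with one of the last `n - s`. -/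
def join {A : Type*} {n s : ℕ} (h : s ≤ n) (x : Fin s → A) (z : Fin (n - s) → A) : Fin n → A :=
  fun i => Fin.append x z (Fin.cast (Nat.add_sub_of_le h).symm i)

/-- The partial trace `tr_{n-s}` over the last `n - s` of `n` systems. -/
def trLast {A : Type*} [Fintype A] {n s : ℕ} (h : s ≤ n) (ρ : Matrix (Fin n → A) (Fin n → A) ℂ) :
    Matrix (Fin s → A) (Fin s → A) ℂ :=
  Matrix.of fun x y => ∑ z : Fin (n - s) → A, ρ (join h x z) (join h y z)

/-- The partial trace over `E` of an operator on `AE`. -/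
def trE {A E : Type*} [Fintype E] (M : Matrix (A × E) (A × E) ℂ) : Matrix A A ℂ :=
  Matrix.of fun a b => ∑ e, M (a, e) (b, e)

/-- The partial trace over `E₁ … Eₙ` of an operator on `A₁E₁ … AₙEₙ`. -/
def trEs {A E : Type*} [Fintype E] {n : ℕ}
    (M : Matrix (Fin n → A × E) (Fin n → A × E) ℂ) : Matrix (Fin n → A) (Fin n → A) ℂ :=
  Matrix.of fun x y => ∑ z : Fin n → E, M (fun i => (x i, z i)) (fun i => (y i, z i))

/-- `θ` is a purification of `σ`: a vector of `AE` with `tr_E |θ⟩⟨θ| = σ`. -/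
def IsPurification {A E : Type*} [Fintype E]
    (θ : EuclideanSpace ℂ (A × E)) (σ : Matrix A A ℂ) : Prop :=
  trE (Matrix.vecMulVec θ.ofLp (star θ.ofLp)) = σ

/-- The operator on an `n`-fold tensor power that permutes the tensor factors by `π`. -/
def permVec {X : Type*} {n : ℕ} (π : Equiv.Perm (Fin n)) (ψ : EuclideanSpace ℂ (Fin n → X)) :
    EuclideanSpace ℂ (Fin n → X) :=
  WithLp.toLp 2 fun x => ψ (x ∘ π)

/-- `M` is invariant under all permutations of the tensor factors: the matrix entries of
`π M π†` are those of `M` at permuted configurations. -/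
def IsPermInvariant {X : Type*} {n : ℕ} (M : Matrix (Fin n → X) (Fin n → X) ℂ) : Prop :=
  ∀ π : Equiv.Perm (Fin n), M.submatrix (fun x => x ∘ π) (fun x => x ∘ π) = M

/-- The vector `θ^{⊗ m} ⊗ Ω` of an `n`-fold tensor power, where `Ω` is a vector on the last
`n - m` factors. -/
def powTensor {X : Type*} {n m : ℕ} (h : m ≤ n) (θ : EuclideanSpace ℂ X)
    (Ω : EuclideanSpace ℂ (Fin (n - m) → X)) : EuclideanSpace ℂ (Fin n → X) :=
  WithLp.toLp 2 fun x =>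
    (∏ i : Fin m, θ (x (Fin.castLE h i))) *
      Ω (fun j => x (Fin.cast (Nat.add_sub_of_le h) (Fin.natAdd m j)))

/-- The set of vectors `π (θ^{⊗ m} ⊗ Ω)` of an `n`-fold tensor power, for all permutations `π`
and all vectors `Ω` on `n - m` factors. -/
def defectVectors {X : Type*} {n m : ℕ} (h : m ≤ n) (θ : EuclideanSpace ℂ X) :
    Set (EuclideanSpace ℂ (Fin n → X)) :=
  {ψ | ∃ (π : Equiv.Perm (Fin n)) (Ω : EuclideanSpace ℂ (Fin (n - m) → X)),
    ψ = permVec π (powTensor h θ Ω)}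

/-- `ρ` is an `(n choose r)`-almost-iid state in `σ` (for `r ≤ n`): there are a finite-dimensional
system `E`, a purification `θ` of `σ` on `AE`, and a density matrix `R` on `A₁E₁ … AₙEₙ` that
extends `ρ`, is invariant under permutations of the pairs `(Aᵢ, Eᵢ)`, and has its support in the
span of the vectors `π (θ^{⊗ (n-r)} ⊗ Ω)`. -/
def IsAlmostIID {A : Type*} [Fintype A] [DecidableEq A] {n : ℕ} (r : ℕ)
    (σ : Matrix A A ℂ) (ρ : Matrix (Fin n → A) (Fin n → A) ℂ) : Prop :=
  IsDensity ρ ∧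
  ∃ (d : ℕ) (θ : EuclideanSpace ℂ (A × Fin d))
    (R : Matrix (Fin n → A × Fin d) (Fin n → A × Fin d) ℂ),
    IsPurification θ σ ∧ IsDensity R ∧ trEs R = ρ ∧ IsPermInvariant R ∧
      supp R ≤ Submodule.span ℂ (defectVectors (Nat.sub_le n r) θ)

end AlmostIID

end

open scoped ComplexOrder InnerProductSpace Kronecker

/-- A linear endomorphism has a contraction realising the sum of its singular values as a trace. -/
theorem LinearMap.exists_contraction_trace_eq_sum_singularValues {E : Type*}
    [NormedAddCommGroup E] [InnerProductSpace ℂ E] [FiniteDimensional ℂ E] (T : E →ₗ[ℂ] E) :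
    ∃ S : E →ₗ[ℂ] E, (∀ w, ‖S w‖ ≤ ‖w‖) ∧
      LinearMap.trace ℂ E (S ∘ₗ T) =
        ((∑ i ∈ Finset.range (Module.finrank ℂ E), T.singularValues i : ℝ) : ℂ) := by
  classical
  set hT := T.isSymmetric_adjoint_comp_self
  let b := hT.eigenvectorBasis rfl
  have hb : ∀ i j, ⟪T (b i), T (b j)⟫_ℂ =
      if i = j then ((T.singularValues j : ℂ)) ^ 2 else 0 := by
    intro i j
    rw [← LinearMap.adjoint_inner_right, ← LinearMap.comp_apply]
    have h := hT.apply_eigenvectorBasis rfl j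
    rw [show (LinearMap.adjoint T ∘ₗ T) (b j) = _ from h, inner_smul_right,
      ← T.sq_singularValues_fin rfl j]
    rw [show ⟪b i, hT.eigenvectorBasis rfl j⟫_ℂ = if i = j then 1 else 0 from
      orthonormal_iff_ite.mp b.orthonormal i j]
    split_ifs <;> simp
  let u : Fin (Module.finrank ℂ E) → E := fun i => ((T.singularValues i : ℂ))⁻¹ • T (b i)
  have hu : Orthonormal ℂ fun i : {i : Fin (Module.finrank ℂ E) // T.singularValues i ≠ 0} =>
      u i := by
    rw [orthonormal_iff_ite]
    rintro ⟨i, hi⟩ ⟨j, hj⟩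
    have hj' : (T.singularValues j : ℂ) ≠ 0 := by exact_mod_cast hj
    simp only [u, inner_smul_left, inner_smul_right, hb, Subtype.mk.injEq]
    split_ifs with h
    · subst h
      simp only [map_inv₀, Complex.conj_ofReal]
      field_simp
    · simp
  let S : E →ₗ[ℂ] E := ∑ i, (innerₛₗ ℂ (u i)).smulRight (b i)
  have hS : ∀ w i, ⟪b i, S w⟫_ℂ = ⟪u i, w⟫_ℂ := by
    intro w i
    simp [S, orthonormal_iff_ite.mp b.orthonormal]
  refine ⟨S, fun w => ?_, ?_⟩
  · rw [← sq_le_sq₀ (norm_nonneg _) (norm_nonneg _), ← b.sum_sq_norm_inner_right (S w)]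
    simp only [hS]
    have h := hu.sum_inner_products_le w (s := Finset.univ)
    refine le_trans (le_of_eq ?_) h
    rw [← Finset.sum_subtype (Finset.univ.filter fun i : Fin (Module.finrank ℂ E) =>
      T.singularValues i ≠ 0) (by simp) (fun i => ‖⟪u i, w⟫_ℂ‖ ^ 2), Finset.sum_filter_of_ne]
    intro i _ hne h0
    simp [u, h0] at hne
  · rw [LinearMap.trace_eq_sum_inner _ b, Finset.sum_range]
    push_cast
    refine Finset.sum_congr rfl fun i _ => ?_
    rw [Function.comp_apply, hS, inner_smul_left, hb]
    by_cases h : (T.singularValues i : ℂ) = 0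
    · simp [h]
    · simp only [map_inv₀, Complex.conj_ofReal, if_true]
      field_simp

namespace Matrix

variable {X Y : Type*} [Fintype X] [DecidableEq X] [Fintype Y] [DecidableEq Y]

theorem posSemidef_one_sub_conjTranspose_mul_self_iff {S : Matrix X X ℂ} :
    (1 - Sᴴ * S).PosSemidef ↔ ∀ w, ‖toEuclideanLin S w‖ ≤ ‖w‖ := by
  have key : ∀ w : EuclideanSpace ℂ X, star w.ofLp ⬝ᵥ ((1 - Sᴴ * S) *ᵥ w.ofLp) =
      ((‖w‖ ^ 2 - ‖toEuclideanLin S w‖ ^ 2 : ℝ) : ℂ) := by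
    intro w
    rw [Matrix.sub_mulVec, dotProduct_sub, one_mulVec, ← mulVec_mulVec, dotProduct_mulVec _ Sᴴ,
      ← star_mulVec]
    push_cast
    have h : ∀ v : EuclideanSpace ℂ X, star v.ofLp ⬝ᵥ v.ofLp = (‖v‖ : ℂ) ^ 2 := by
      intro v
      have h := inner_self_eq_norm_sq_to_K (𝕜 := ℂ) v
      rw [EuclideanSpace.inner_eq_star_dotProduct, dotProduct_comm] at h
      exact h
    rw [h, ← h (toEuclideanLin S w)]
    rfl
  rw [posSemidef_iff_dotProduct_mulVec]
  constructor
  · intro h w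
    have h1 := h.2 w.ofLp
    rw [key, Complex.zero_le_real] at h1
    exact (sq_le_sq₀ (norm_nonneg _) (norm_nonneg _)).mp (by linarith)
  · intro h
    refine ⟨?_, fun x => ?_⟩
    · simp [IsHermitian]
    · have := key (WithLp.toLp 2 x)
      simp only at this
      rw [this, Complex.zero_le_real]
      have := (sq_le_sq₀ (norm_nonneg _) (norm_nonneg _)).mpr (h (WithLp.toLp 2 x))
      linarith

theorem norm_toEuclideanLin_kronecker_one_le {S : Matrix X X ℂ}
    (hS : ∀ w, ‖toEuclideanLin S w‖ ≤ ‖w‖) (w : EuclideanSpace ℂ (X × Y)) :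
    ‖toEuclideanLin (S ⊗ₖ (1 : Matrix Y Y ℂ)) w‖ ≤ ‖w‖ := by
  revert w
  rw [← posSemidef_one_sub_conjTranspose_mul_self_iff] at hS ⊢
  have h := hS.kronecker (PosSemidef.one (n := Y) (R := ℂ))
  have e : 1 - (S ⊗ₖ (1 : Matrix Y Y ℂ))ᴴ * (S ⊗ₖ (1 : Matrix Y Y ℂ)) =
      (1 - Sᴴ * S) ⊗ₖ (1 : Matrix Y Y ℂ) := by
    rw [conjTranspose_kronecker, ← mul_kronecker_mul]
    ext ⟨x, y⟩ ⟨x', y'⟩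
    by_cases h : y = y' <;> simp [one_apply, h]
  rw [e]
  exact h

end Matrix

namespace AlmostIID

theorem exists_contraction_trace_mul_eq_traceNorm {X : Type*} [Fintype X] [DecidableEq X]
    (M : Matrix X X ℂ) : ∃ S : Matrix X X ℂ, (∀ w, ‖Matrix.toEuclideanLin S w‖ ≤ ‖w‖) ∧
      (S * M).trace = (traceNorm M : ℂ) := by
  obtain ⟨S, hS, h⟩ :=
    (Matrix.toEuclideanLin M).exists_contraction_trace_eq_sum_singularValues
  refine ⟨Matrix.toEuclideanLin.symm S, by simpa using hS, ?_⟩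
  rw [finrank_euclideanSpace] at h
  rw [traceNorm, ← h]
  obtain ⟨S, rfl⟩ := Matrix.toEuclideanLin.surjective S
  rw [LinearEquiv.symm_apply_apply, Matrix.toEuclideanLin_eq_toLin_orthonormal,
    ← Matrix.toLin_mul, Matrix.trace_toLin_eq]

theorem trace_mul_trE {A E : Type*} [Fintype A] [DecidableEq A] [Fintype E] [DecidableEq E]
    (S : Matrix A A ℂ) (D : Matrix (A × E) (A × E) ℂ) :
    (S * trE D).trace = ((S ⊗ₖ (1 : Matrix E E ℂ)) * D).trace := by
  simp only [Matrix.trace, Matrix.diag, Matrix.mul_apply, trE, Matrix.of_apply,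
    Matrix.kroneckerMap_apply, Fintype.sum_prod_type, Finset.mul_sum, Matrix.one_apply]
  refine Finset.sum_congr rfl fun a _ => ?_
  rw [Finset.sum_comm]
  simp

end AlmostIID

section PureState

variable {H ι : Type*} [NormedAddCommGroup H] [InnerProductSpace ℂ H] [Fintype ι]

theorem norm_sub_inner_smul_sq {Θ : H} (hΘ : ‖Θ‖ = 1) (b : H) :
    ‖b - ⟪Θ, b⟫_ℂ • Θ‖ ^ 2 = ‖b‖ ^ 2 - ‖⟪Θ, b⟫_ℂ‖ ^ 2 := by
  have h0 : ⟪b - ⟪Θ, b⟫_ℂ • Θ, ⟪Θ, b⟫_ℂ • Θ⟫_ℂ = 0 := by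
    rw [inner_sub_left, inner_smul_left, inner_smul_right, inner_smul_right,
      inner_self_eq_norm_sq_to_K, hΘ, ← inner_conj_symm b Θ]
    simp
    ring
  have h := norm_add_sq_eq_norm_sq_add_norm_sq_of_inner_eq_zero (𝕜 := ℂ) _ _ h0
  rw [sub_add_cancel, norm_smul, hΘ] at h
  nlinarith

/-- An ensemble that overlaps a unit vector `Θ` up to `δ` has nearly the same expectation of every
contraction as `Θ`. -/
theorem norm_sum_inner_sub_inner_le {Θ : H} (hΘ : ‖Θ‖ = 1) {K : H →ₗ[ℂ] H}
    (hK : ∀ w, ‖K w‖ ≤ ‖w‖) (b : ι → H) (hb : ∑ k, ‖b k‖ ^ 2 = 1) {δ : ℝ}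
    (hδ : 1 - δ ≤ ∑ k, ‖⟪Θ, b k⟫_ℂ‖ ^ 2) :
    ‖∑ k, ⟪b k, K (b k)⟫_ℂ - ⟪Θ, K Θ⟫_ℂ‖ ≤ 3 * √δ := by
  set p : ι → H := fun k => ⟪Θ, b k⟫_ℂ • Θ
  set q : ι → H := fun k => b k - p k
  set F := ∑ k, ‖⟪Θ, b k⟫_ℂ‖ ^ 2
  have hq : ∑ k, ‖q k‖ ^ 2 = 1 - F := by
    simp only [q, p, norm_sub_inner_smul_sq hΘ, Finset.sum_sub_distrib, hb, F]
  have hp : ∀ k, ‖p k‖ ≤ ‖b k‖ := fun k => by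
    simpa [p, norm_smul, hΘ] using norm_inner_le_norm (𝕜 := ℂ) Θ (b k)
  have hF0 : 0 ≤ F := by positivity
  have hF1 : 0 ≤ 1 - F := by rw [← hq]; positivity
  have hqb : ∑ k, ‖q k‖ * ‖b k‖ ≤ √(1 - F) := by
    have h := Real.sum_mul_le_sqrt_mul_sqrt Finset.univ (fun k => ‖q k‖) fun k => ‖b k‖
    simpa [hq, hb] using h
  have hterm : ∀ k, ⟪b k, K (b k)⟫_ℂ = ⟪q k, K (b k)⟫_ℂ + ⟪p k, K (q k)⟫_ℂ +
      ((‖⟪Θ, b k⟫_ℂ‖ ^ 2 : ℝ) : ℂ) * ⟪Θ, K Θ⟫_ℂ := by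
    intro k
    have h1 : ((‖⟪Θ, b k⟫_ℂ‖ ^ 2 : ℝ) : ℂ) * ⟪Θ, K Θ⟫_ℂ = ⟪p k, K (p k)⟫_ℂ := by
      simp only [p, map_smul, inner_smul_left, inner_smul_right]
      rw [← mul_assoc, Complex.mul_conj']
      push_cast
      ring
    rw [h1, add_assoc, ← inner_add_right, ← map_add, sub_add_cancel, ← inner_add_left,
      sub_add_cancel]
  have hΘK : ‖⟪Θ, K Θ⟫_ℂ‖ ≤ 1 := by
    have := (norm_inner_le_norm (𝕜 := ℂ) Θ (K Θ)).trans
      (mul_le_mul_of_nonneg_left (hK Θ) (norm_nonneg _))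
    simpa [hΘ] using this
  have hsum : ∑ k, ⟪b k, K (b k)⟫_ℂ - ⟪Θ, K Θ⟫_ℂ = ∑ k, ⟪q k, K (b k)⟫_ℂ +
      ∑ k, ⟪p k, K (q k)⟫_ℂ - ((1 - F : ℝ) : ℂ) * ⟪Θ, K Θ⟫_ℂ := by
    simp only [hterm, Finset.sum_add_distrib, ← Finset.sum_mul, F]
    push_cast
    ring
  have hA : ‖∑ k, ⟪q k, K (b k)⟫_ℂ‖ ≤ √(1 - F) :=
    (norm_sum_le_of_le _ fun k _ => (norm_inner_le_norm _ _).trans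
      (mul_le_mul_of_nonneg_left (hK _) (norm_nonneg _))).trans hqb
  have hB : ‖∑ k, ⟪p k, K (q k)⟫_ℂ‖ ≤ √(1 - F) := by
    refine (norm_sum_le_of_le _ fun k _ => ?_).trans hqb
    calc ‖⟪p k, K (q k)⟫_ℂ‖ ≤ ‖p k‖ * ‖K (q k)‖ := norm_inner_le_norm _ _
      _ ≤ ‖b k‖ * ‖q k‖ := mul_le_mul (hp k) (hK _) (norm_nonneg _) (norm_nonneg _)
      _ = ‖q k‖ * ‖b k‖ := mul_comm _ _
  have hC : ‖((1 - F : ℝ) : ℂ) * ⟪Θ, K Θ⟫_ℂ‖ ≤ √(1 - F) := by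
    rw [norm_mul, Complex.norm_real, Real.norm_of_nonneg hF1]
    have : 1 - F ≤ √(1 - F) := Real.le_sqrt_of_sq_le (by nlinarith)
    nlinarith [norm_nonneg ⟪Θ, K Θ⟫_ℂ]
  have hFδ : √(1 - F) ≤ √δ := Real.sqrt_le_sqrt (by linarith)
  rw [hsum]
  refine (norm_sub_le _ _).trans ?_
  have := norm_add_le (∑ k, ⟪q k, K (b k)⟫_ℂ) (∑ k, ⟪p k, K (q k)⟫_ℂ)
  linarith

end PureState

namespace AlmostIID

open Matrix

theorem PosSemidef.exists_ensemble {X : Type*} [Fintype X] [DecidableEq X] {R : Matrix X X ℂ}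
    (hR : R.PosSemidef) : ∃ b : X → EuclideanSpace ℂ X, (∀ k, b k ∈ supp R) ∧
      ∀ K : Matrix X X ℂ, (K * R).trace = ∑ k, ⟪b k, toEuclideanLin K (b k)⟫_ℂ := by
  obtain ⟨C, rfl⟩ : ∃ C : Matrix X X ℂ, R = Cᴴ * C := by
    open scoped MatrixOrder in
    exact CStarAlgebra.nonneg_iff_eq_star_mul_self.mp hR.nonneg
  refine ⟨fun k => WithLp.toLp 2 (Cᴴ.col k), fun k => ?_, fun K => ?_⟩
  · rw [supp, Submodule.mem_orthogonal]
    intro v hv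
    have h0 : C *ᵥ v.ofLp = 0 := by
      have hv' : (Cᴴ * C) *ᵥ v.ofLp = 0 := congrArg WithLp.ofLp (LinearMap.mem_ker.mp hv)
      exact (conjTranspose_mul_self_mulVec_eq_zero C _).mp hv'
    rw [EuclideanSpace.inner_eq_star_dotProduct]
    have h1 := congrArg star (congrFun h0 k)
    simpa [mulVec, dotProduct, mul_comm] using h1
  · rw [← mul_assoc, trace_mul_comm, ← mul_assoc]
    simp only [trace, diag, EuclideanSpace.inner_eq_star_dotProduct]
    refine Finset.sum_congr rfl fun k _ => ?_
    rw [mul_assoc, mul_apply, dotProduct]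
    refine Finset.sum_congr rfl fun x _ => ?_
    simp [mul_apply, mulVec, dotProduct, mul_comm]

theorem IsDensity.sum_norm_sq_eq_one {X ι : Type*} [Fintype X] [DecidableEq X] [Fintype ι]
    {R : Matrix X X ℂ} (hR : IsDensity R) {b : ι → EuclideanSpace ℂ X}
    (hb : ∀ K : Matrix X X ℂ, (K * R).trace = ∑ k, ⟪b k, toEuclideanLin K (b k)⟫_ℂ) :
    ∑ k, ‖b k‖ ^ 2 = 1 := by
  have h := hb 1
  rw [one_mul, hR.2] at h
  have e : ∀ k, ⟪b k, toEuclideanLin (1 : Matrix X X ℂ) (b k)⟫_ℂ = ((‖b k‖ ^ 2 : ℝ) : ℂ) := by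
    intro k
    rw [toLpLin_one]
    simp
  simp only [e, ← Complex.ofReal_sum] at h
  exact_mod_cast h.symm

/-- A bipartite density operator close to a pure state has a marginal close to that of the pure
state. -/
theorem traceNorm_trE_sub_le {A E : Type*} [Fintype A] [DecidableEq A] [Fintype E] [DecidableEq E]
    {D : Matrix (A × E) (A × E) ℂ} (hD : IsDensity D) {Θ : EuclideanSpace ℂ (A × E)}
    (hΘ : ‖Θ‖ = 1) {δ : ℝ}
    (hδ : 1 - δ ≤ (vecMulVec Θ.ofLp (star Θ.ofLp) * D).trace.re) :
    traceNorm (trE (D - vecMulVec Θ.ofLp (star Θ.ofLp))) ≤ 3 * √δ := by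
  obtain ⟨S, hS, hSM⟩ := exists_contraction_trace_mul_eq_traceNorm
    (trE (D - vecMulVec Θ.ofLp (star Θ.ofLp)))
  obtain ⟨b, -, hb⟩ := PosSemidef.exists_ensemble hD.1
  have hpure : ∀ K : Matrix (A × E) (A × E) ℂ,
      (K * vecMulVec Θ.ofLp (star Θ.ofLp)).trace = ⟪Θ, toEuclideanLin K Θ⟫_ℂ := by
    intro K
    rw [mul_vecMulVec, trace_vecMulVec, EuclideanSpace.inner_eq_star_dotProduct]
    rfl
  have h1 := hD.sum_norm_sq_eq_one hb
  have h2 : 1 - δ ≤ ∑ k, ‖⟪Θ, b k⟫_ℂ‖ ^ 2 := by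
    refine hδ.trans_eq ?_
    have e : ∀ k, ⟪b k, toEuclideanLin (vecMulVec Θ.ofLp (star Θ.ofLp)) (b k)⟫_ℂ =
        ((‖⟪Θ, b k⟫_ℂ‖ ^ 2 : ℝ) : ℂ) := by
      intro k
      have : toEuclideanLin (vecMulVec Θ.ofLp (star Θ.ofLp)) (b k) = ⟪Θ, b k⟫_ℂ • Θ := by
        ext x
        simp [vecMulVec_mulVec, EuclideanSpace.inner_eq_star_dotProduct, dotProduct_comm, mul_comm]
      rw [this, inner_smul_right, ← inner_conj_symm (b k) Θ, Complex.mul_conj']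
      push_cast
      rfl
    rw [hb]
    simp only [e, ← Complex.ofReal_sum, Complex.ofReal_re]
  have h3 := norm_sum_inner_sub_inner_le hΘ
    (norm_toEuclideanLin_kronecker_one_le (Y := E) hS) b h1 h2
  rw [← hb, ← hpure, ← trace_sub, ← mul_sub, ← trace_mul_trE, hSM, Complex.norm_real] at h3
  exact (le_abs_self _).trans h3

end AlmostIID

section Defects

variable {H ι : Type*} [NormedAddCommGroup H] [InnerProductSpace ℂ H] [DecidableEq ι]

/-- The span of the vectors annihilated by all `Q i` with `i` in a subset of `J` that omits at most
`r` elements of `J`. -/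
def defectSpan (Q : ι → H →ₗ[ℂ] H) (J : Finset ι) (r : ℕ) : Submodule ℂ H :=
  Submodule.span ℂ {v | ∃ T ⊆ J, J.card ≤ T.card + r ∧ ∀ i ∈ T, Q i v = 0}

variable {Q : ι → H →ₗ[ℂ] H} (hcomm : ∀ i j, Commute (Q i) (Q j))

include hcomm in
theorem apply_mem_defectSpan_of_notMem {J : Finset ι} {a : ι} (ha : a ∉ J) {r : ℕ} {ψ : H}
    (hψ : ψ ∈ defectSpan Q (insert a J) r) : ψ - Q a ψ ∈ defectSpan Q J r := by
  suffices h : defectSpan Q (insert a J) r ≤ (defectSpan Q J r).comap (1 - Q a) from h hψ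
  refine Submodule.span_le.mpr ?_
  rintro v ⟨T, hT, hc, hv⟩
  refine Submodule.subset_span ⟨T.erase a, ?_, ?_, fun i hi => ?_⟩
  · grind
  · have := Finset.card_insert_of_notMem ha
    have := Finset.pred_card_le_card_erase (s := T) (a := a)
    omega
  · have h := hv i (Finset.mem_of_mem_erase hi)
    have h2 : Q i (Q a v) = Q a (Q i v) := LinearMap.congr_fun (hcomm i a) v
    simp [h, h2]

include hcomm in
theorem apply_mem_defectSpan {J : Finset ι} {a : ι} (ha : a ∉ J) {r : ℕ} {ψ : H}
    (hψ : ψ ∈ defectSpan Q (insert a J) (r + 1)) : Q a ψ ∈ defectSpan Q J r := by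
  suffices h : defectSpan Q (insert a J) (r + 1) ≤ (defectSpan Q J r).comap (Q a) from h hψ
  refine Submodule.span_le.mpr ?_
  rintro v ⟨T, hT, hc, hv⟩
  by_cases haT : a ∈ T
  · simp [hv a haT]
  refine Submodule.subset_span ⟨T, ?_, ?_, fun i hi => ?_⟩
  · grind
  · have := Finset.card_insert_of_notMem ha
    omega
  · have h2 : Q i (Q a v) = Q a (Q i v) := LinearMap.congr_fun (hcomm i a) v
    simp [h2, hv i hi]

omit [DecidableEq ι] in
theorem apply_eq_zero_of_mem_defectSpan_zero {J : Finset ι} {a : ι} (ha : a ∈ J) {ψ : H}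
    (hψ : ψ ∈ defectSpan Q J 0) : Q a ψ = 0 := by
  suffices h : defectSpan Q J 0 ≤ LinearMap.ker (Q a) from LinearMap.mem_ker.mp (h hψ)
  refine Submodule.span_le.mpr ?_
  rintro v ⟨T, hT, hc, hv⟩
  rw [← Finset.eq_of_subset_of_card_le hT (by simpa using hc)] at ha
  exact hv a ha

theorem LinearMap.IsSymmetricProjection.norm_sq_eq_add {P : H →ₗ[ℂ] H}
    (hP : P.IsSymmetricProjection) (φ : H) : ‖φ‖ ^ 2 = ‖φ - P φ‖ ^ 2 + ‖P φ‖ ^ 2 := by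
  have h0 : ⟪φ - P φ, P φ⟫_ℂ = 0 := by
    have h : P (P φ) = P φ := LinearMap.congr_fun hP.isIdempotentElem φ
    rw [← hP.isSymmetric, map_sub, h, sub_self, inner_zero_left]
  have h := norm_add_sq_eq_norm_sq_add_norm_sq_of_inner_eq_zero (𝕜 := ℂ) _ _ h0
  rw [sub_add_cancel] at h
  nlinarith

include hcomm in
/-- The expected number of defects on the span of the vectors with at most `r` defects is at most
`r`. -/
theorem sum_norm_sq_apply_le_of_mem_defectSpan (hQ : ∀ i, (Q i).IsSymmetricProjection)
    (J : Finset ι) : ∀ (r : ℕ) (ψ : H), ψ ∈ defectSpan Q J r →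
      ∑ i ∈ J, ‖Q i ψ‖ ^ 2 ≤ r * ‖ψ‖ ^ 2 := by
  induction J using Finset.induction_on with
  | empty => intro r ψ _; simp; positivity
  | insert a J ha ih =>
    intro r ψ hψ
    have hsplit : ∀ i, ‖Q i ψ‖ ^ 2 = ‖Q i (ψ - Q a ψ)‖ ^ 2 + ‖Q i (Q a ψ)‖ ^ 2 := by
      intro i
      have h2 : Q i (Q a ψ) = Q a (Q i ψ) := LinearMap.congr_fun (hcomm i a) ψ
      rw [map_sub, h2]
      exact (hQ a).norm_sq_eq_add _
    rw [Finset.sum_insert ha, (hQ a).norm_sq_eq_add ψ, Finset.sum_congr rfl fun i _ => hsplit i,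
      Finset.sum_add_distrib]
    have h0 := ih r _ (apply_mem_defectSpan_of_notMem hcomm ha hψ)
    cases r with
    | zero =>
      have h1 := apply_eq_zero_of_mem_defectSpan_zero (Finset.mem_insert_self a J) hψ
      simp only [h1] at h0 ⊢
      simpa using h0
    | succ r =>
      have h1 := ih r _ (apply_mem_defectSpan hcomm ha hψ)
      push_cast at h0 ⊢
      linarith

end Defects

namespace Matrix

variable {ι X : Type*} [Fintype ι]

/-- The tensor product `⨂ i, M i` of a family of operators. -/
def piTensor (M : ι → Matrix X X ℂ) : Matrix (ι → X) (ι → X) ℂ :=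
  of fun x y => ∏ i, M i (x i) (y i)

theorem piTensor_mul [DecidableEq ι] [Fintype X] (M N : ι → Matrix X X ℂ) :
    piTensor M * piTensor N = piTensor fun i => M i * N i := by
  ext x y
  simp only [piTensor, mul_apply, of_apply, ← Finset.prod_mul_distrib]
  rw [Fintype.prod_sum]

theorem piTensor_conjTranspose (M : ι → Matrix X X ℂ) :
    (piTensor M)ᴴ = piTensor fun i => (M i)ᴴ := by
  ext x y
  simp [piTensor, conjTranspose_apply]

theorem piTensor_one [DecidableEq ι] [DecidableEq X] :
    piTensor (fun _ : ι => (1 : Matrix X X ℂ)) = 1 := by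
  ext x y
  simp [piTensor, one_apply, Finset.prod_ite_zero, funext_iff]

theorem piTensor_submatrix_comp (M : ι → Matrix X X ℂ) (π : Equiv.Perm ι) :
    (piTensor M).submatrix (fun x => x ∘ π) (fun x => x ∘ π) = piTensor (M ∘ π.symm) := by
  ext x y
  simp only [piTensor, submatrix_apply, of_apply, Function.comp_apply]
  rw [← Equiv.prod_comp π fun j => M (π.symm j) (x j) (y j)]
  simp

theorem piTensor_update_add [DecidableEq ι] (M : ι → Matrix X X ℂ) (i : ι)
    (K L : Matrix X X ℂ) : piTensor (Function.update M i (K + L)) =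
      piTensor (Function.update M i K) + piTensor (Function.update M i L) := by
  ext x y
  simp only [piTensor, of_apply, add_apply]
  rw [← Finset.mul_prod_erase _ _ (Finset.mem_univ i),
    ← Finset.mul_prod_erase _ _ (Finset.mem_univ i),
    ← Finset.mul_prod_erase _ _ (Finset.mem_univ i)]
  have : ∀ N : Matrix X X ℂ, ∏ j ∈ Finset.univ.erase i, Function.update M i N j (x j) (y j) =
      ∏ j ∈ Finset.univ.erase i, M j (x j) (y j) := fun N =>
    Finset.prod_congr rfl fun j hj => by rw [Function.update_of_ne (Finset.ne_of_mem_erase hj)]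
  simp only [this, Function.update_self, add_apply, add_mul]

/-- The operator acting as `M` on site `i` and trivially elsewhere. -/
def site [DecidableEq ι] [DecidableEq X] (i : ι) (M : Matrix X X ℂ) :
    Matrix (ι → X) (ι → X) ℂ :=
  piTensor (Function.update (fun _ => 1) i M)

variable [DecidableEq ι] [DecidableEq X]

theorem site_mul_site_same [Fintype X] (i : ι) (M N : Matrix X X ℂ) :
    site i M * site i N = site i (M * N) := by
  rw [site, site, piTensor_mul, site]
  congr 1
  ext1 j
  rcases eq_or_ne j i with rfl | h <;> simp [*]

theorem site_commute [Fintype X] (i j : ι) (M : Matrix X X ℂ) :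
    Commute (site i M) (site j M) := by
  rw [Commute, SemiconjBy, site, site, piTensor_mul, piTensor_mul]
  congr 1
  ext1 k
  rcases eq_or_ne k i with rfl | h <;> rcases eq_or_ne k j with rfl | h' <;> simp [*]

theorem site_isHermitian {M : Matrix X X ℂ} (hM : M.IsHermitian) (i : ι) :
    (site i M).IsHermitian := by
  rw [IsHermitian, site, piTensor_conjTranspose]
  congr 1
  ext1 k
  rcases eq_or_ne k i with rfl | h <;> simp [*, hM.eq]

theorem site_add_site_one_sub (i : ι) (M : Matrix X X ℂ) : site i M + site i (1 - M) = 1 := by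
  rw [site, site, ← piTensor_update_add, add_sub_cancel, Function.update_eq_self_iff.mpr rfl,
    piTensor_one]

theorem site_mulVec_apply [Fintype X] (i : ι) (M : Matrix X X ℂ) (ψ : (ι → X) → ℂ) (x : ι → X) :
    (site i M *ᵥ ψ) x = ∑ a, M (x i) a * ψ (Function.update x i a) := by
  have hinj : Function.Injective fun a => Function.update x i a := Function.update_injective x i
  rw [mulVec, dotProduct, ← Finset.sum_subset (Finset.subset_univ
    (Finset.univ.map ⟨_, hinj⟩)), Finset.sum_map]
  · refine Finset.sum_congr rfl fun a _ => ?_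
    congr 1
    rw [site, piTensor, of_apply, ← Finset.mul_prod_erase _ _ (Finset.mem_univ i),
      Finset.prod_eq_one]
    · simp
    · intro j hj
      simp [Finset.ne_of_mem_erase hj]
  · intro y _ hy
    obtain ⟨j, hj, hxy⟩ : ∃ j, j ≠ i ∧ x j ≠ y j := by
      by_contra! hcon
      refine hy (Finset.mem_map.mpr ⟨y i, Finset.mem_univ _, ?_⟩)
      ext1 j
      rcases eq_or_ne j i with rfl | h <;> simp [*]
    rw [site, piTensor, of_apply, Finset.prod_eq_zero (Finset.mem_univ j), zero_mul]
    simp [hj, hxy]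

end Matrix

namespace AlmostIID

open Matrix

section Join

variable {A E : Type*} {n s : ℕ} (h : s ≤ n)

@[simp]
theorem join_castLE (x : Fin s → A) (z : Fin (n - s) → A) (i : Fin s) :
    join h x z (Fin.castLE h i) = x i := by
  rw [join, show Fin.cast (Nat.add_sub_of_le h).symm (Fin.castLE h i) = Fin.castAdd (n - s) i from
    rfl, Fin.append_left]

@[simp]
theorem join_natAdd (x : Fin s → A) (z : Fin (n - s) → A) (j : Fin (n - s)) :
    join h x z (Fin.cast (Nat.add_sub_of_le h) (Fin.natAdd s j)) = z j := by
  simp [join]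

theorem forall_fin_iff_castLE_natAdd {p : Fin n → Prop} : (∀ i, p i) ↔
    (∀ i, p (Fin.castLE h i)) ∧ ∀ j, p (Fin.cast (Nat.add_sub_of_le h) (Fin.natAdd s j)) := by
  refine ⟨fun hp => ⟨fun i => hp _, fun j => hp _⟩, fun hp i => ?_⟩
  rcases lt_or_ge i.val s with hi | hi
  · exact hp.1 ⟨i, hi⟩
  · convert hp.2 ⟨i - s, by omega⟩
    simp [hi]

theorem prod_eq_prod_castLE_mul_prod_natAdd {M : Type*} [CommMonoid M] (f : Fin n → M) :
    ∏ i, f i = (∏ i, f (Fin.castLE h i)) *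
      ∏ j, f (Fin.cast (Nat.add_sub_of_le h) (Fin.natAdd s j)) := by
  rw [← Equiv.prod_comp (finCongr (Nat.add_sub_of_le h)), Fin.prod_univ_add]
  rfl

/-- A configuration of `n` systems is a configuration of the first `s` and one of the others. -/
def joinEquiv : (Fin s → A) × (Fin (n - s) → A) ≃ (Fin n → A) where
  toFun p := join h p.1 p.2
  invFun x := (fun i => x (Fin.castLE h i),
    fun j => x (Fin.cast (Nat.add_sub_of_le h) (Fin.natAdd s j)))
  left_inv p := by simp
  right_inv x := by
    ext1 i
    revert i
    rw [forall_fin_iff_castLE_natAdd h]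
    simp

theorem sum_eq_sum_join [Fintype A] {M : Type*} [AddCommMonoid M] (f : (Fin n → A) → M) :
    ∑ x, f x = ∑ x, ∑ z, f (join h x z) := by
  rw [← Equiv.sum_comp (joinEquiv h), Fintype.sum_prod_type]
  rfl

theorem join_prodMk (x : Fin s → A) (u : Fin s → E) (z : Fin (n - s) → A)
    (w : Fin (n - s) → E) : (fun i => (join h x z i, join h u w i)) =
      join h (fun i => (x i, u i)) fun j => (z j, w j) := by
  ext1 i
  revert i
  rw [forall_fin_iff_castLE_natAdd h]
  simp

theorem trLast_eq_sum_submatrix [Fintype A] (R : Matrix (Fin n → A) (Fin n → A) ℂ) :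
    trLast h R = ∑ z, R.submatrix (fun x => join h x z) fun x => join h x z := by
  ext x y
  simp [trLast, Matrix.sum_apply]

theorem IsDensity.trLast [Fintype A] {R : Matrix (Fin n → A) (Fin n → A) ℂ} (hR : IsDensity R) :
    IsDensity (trLast h R) := by
  constructor
  · rw [trLast_eq_sum_submatrix]
    exact posSemidef_sum _ fun z _ => hR.1.submatrix _
  · rw [← hR.2, trace, trace, sum_eq_sum_join h]
    rfl

/-- The equivalence pairing configurations of `A₁ … Aₛ` and `E₁ … Eₛ`. -/
def pairEquiv (A E : Type*) (s : ℕ) : (Fin s → A) × (Fin s → E) ≃ (Fin s → A × E) :=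
  (Equiv.arrowProdEquivProdArrow (Fin s) (fun _ => A) fun _ => E).symm

theorem pairEquiv_apply (p : (Fin s → A) × (Fin s → E)) :
    pairEquiv A E s p = fun i => (p.1 i, p.2 i) := rfl

theorem sum_eq_sum_pair [Fintype A] [Fintype E] {M : Type*} [AddCommMonoid M]
    (f : (Fin s → A × E) → M) : ∑ x, f x = ∑ x : Fin s → A, ∑ z : Fin s → E, f fun i => (x i, z i) := by
  rw [← Equiv.sum_comp (pairEquiv A E s), Fintype.sum_prod_type]
  rfl

theorem trLast_trEs [Fintype A] [Fintype E] (R : Matrix (Fin n → A × E) (Fin n → A × E) ℂ) :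
    trLast h (trEs R) = trE ((trLast h R).submatrix (pairEquiv A E s) (pairEquiv A E s)) := by
  ext x y
  simp only [trLast, trEs, trE, of_apply, submatrix_apply, pairEquiv_apply, sum_eq_sum_join h,
    sum_eq_sum_pair, join_prodMk]
  exact Finset.sum_comm

/-- The `s`-fold tensor power of a vector. -/
def vecPow {X : Type*} (θ : EuclideanSpace ℂ X) (s : ℕ) : EuclideanSpace ℂ (Fin s → X) :=
  WithLp.toLp 2 fun x => ∏ i, θ (x i)

theorem tensorPow_eq_trE [Fintype E] {θ : EuclideanSpace ℂ (A × E)} {σ : Matrix A A ℂ}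
    (hθ : IsPurification θ σ) : tensorPow σ s =
      trE ((vecMulVec (vecPow θ s).ofLp (star (vecPow θ s).ofLp)).submatrix
        (pairEquiv A E s) (pairEquiv A E s)) := by
  subst hθ
  ext x y
  simp only [tensorPow, trE, of_apply, submatrix_apply, pairEquiv_apply, vecMulVec_apply, vecPow,
    Pi.star_apply, star_prod, ← Finset.prod_mul_distrib]
  rw [Fintype.prod_sum]

theorem norm_vecPow {X : Type*} [Fintype X] {θ : EuclideanSpace ℂ X} (hθ : ‖θ‖ = 1) :
    ‖vecPow θ s‖ = 1 := by
  have h1 : ∑ a, ‖θ a‖ ^ 2 = 1 := by rw [← EuclideanSpace.norm_sq_eq, hθ, one_pow]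
  rw [← sq_eq_sq₀ (norm_nonneg _) zero_le_one, EuclideanSpace.norm_sq_eq]
  simp only [vecPow, norm_prod, ← Finset.prod_pow]
  rw [← Fintype.prod_sum fun (_ : Fin s) a => ‖θ a‖ ^ 2]
  simp [h1]

theorem IsPurification.norm_eq_one [Fintype A] [Fintype E] {θ : EuclideanSpace ℂ (A × E)}
    {σ : Matrix A A ℂ} (hθ : IsPurification θ σ) (hσ : IsDensity σ) : ‖θ‖ = 1 := by
  have h := hσ.2
  rw [← hθ] at h
  have e : (trE (vecMulVec θ.ofLp (star θ.ofLp))).trace = ((‖θ‖ ^ 2 : ℝ) : ℂ) := by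
    rw [EuclideanSpace.norm_sq_eq, Fintype.sum_prod_type]
    simp [trace, trE, vecMulVec_apply, Complex.mul_conj']
  rw [e] at h
  exact (sq_eq_sq₀ (norm_nonneg _) zero_le_one).mp (by rw [one_pow]; exact_mod_cast h)

end Join

section Projections

variable {X : Type*}

theorem isHermitian_vecMulVec_star (θ : X → ℂ) : (vecMulVec θ (star θ)).IsHermitian := by
  rw [IsHermitian, conjTranspose_vecMulVec, star_star]

variable [Fintype X] {θ : EuclideanSpace ℂ X}

theorem vecMulVec_star_mul_self (hθ : ‖θ‖ = 1) :
    vecMulVec θ.ofLp (star θ.ofLp) * vecMulVec θ.ofLp (star θ.ofLp) =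
      vecMulVec θ.ofLp (star θ.ofLp) := by
  have h := inner_self_eq_norm_sq_to_K (𝕜 := ℂ) θ
  rw [EuclideanSpace.inner_eq_star_dotProduct, dotProduct_comm, hθ] at h
  rw [vecMulVec_mul_vecMulVec, h]
  simp

theorem trace_mul_nonneg_of_isHermitian_of_idempotent {Y : Type*} [Fintype Y] {P R : Matrix Y Y ℂ}
    (hP : P.IsHermitian) (hPP : P * P = P) (hR : R.PosSemidef) : 0 ≤ (P * R).trace.re := by
  have h := (hR.mul_mul_conjTranspose_same P).trace_nonneg
  rw [hP.eq, mul_assoc, trace_mul_comm, mul_assoc, hPP, trace_mul_comm] at h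
  exact (Complex.le_def.mp h).1

variable [DecidableEq X] {ι : Type*} [Fintype ι] [DecidableEq ι]

/-- The projection onto the vectors that have `θ` on all sites in `J`. -/
def sitesProj (θ : EuclideanSpace ℂ X) (J : Finset ι) : Matrix (ι → X) (ι → X) ℂ :=
  piTensor fun i => if i ∈ J then vecMulVec θ.ofLp (star θ.ofLp) else 1

/-- The projection onto the vectors orthogonal to `θ` on site `i`. -/
def siteDefect (θ : EuclideanSpace ℂ X) (i : ι) : Matrix (ι → X) (ι → X) ℂ :=
  site i (1 - vecMulVec θ.ofLp (star θ.ofLp))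

omit [Fintype X] in
theorem sitesProj_isHermitian (θ : EuclideanSpace ℂ X) (J : Finset ι) :
    (sitesProj θ J).IsHermitian := by
  rw [IsHermitian, sitesProj, piTensor_conjTranspose]
  congr 1
  ext1 i
  split_ifs
  · exact isHermitian_vecMulVec_star _
  · exact conjTranspose_one

theorem sitesProj_mul_self (hθ : ‖θ‖ = 1) (J : Finset ι) :
    sitesProj θ J * sitesProj θ J = sitesProj θ J := by
  rw [sitesProj, piTensor_mul]
  congr 1
  ext1 i
  split_ifs
  · exact vecMulVec_star_mul_self hθ
  · exact one_mul 1

omit [Fintype X] in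
theorem siteDefect_isHermitian (θ : EuclideanSpace ℂ X) (i : ι) :
    (siteDefect θ i).IsHermitian :=
  site_isHermitian (isHermitian_one.sub (isHermitian_vecMulVec_star _)) i

theorem siteDefect_mul_self (hθ : ‖θ‖ = 1) (i : ι) :
    siteDefect θ i * siteDefect θ i = siteDefect θ i := by
  rw [siteDefect, site_mul_site_same]
  congr 1
  simp [sub_mul, mul_sub, vecMulVec_star_mul_self hθ]

theorem sitesProj_commute_siteDefect {J : Finset ι} {a : ι} (ha : a ∉ J) :
    Commute (sitesProj θ J) (siteDefect θ a) := by
  rw [Commute, SemiconjBy, siteDefect, site, sitesProj, piTensor_mul, piTensor_mul]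
  congr 1
  ext1 i
  rcases eq_or_ne i a with rfl | h <;> simp [*]

theorem sitesProj_insert {J : Finset ι} {a : ι} (ha : a ∉ J) :
    sitesProj θ (insert a J) = sitesProj θ J - sitesProj θ J * siteDefect θ a := by
  have h : sitesProj θ (insert a J) = sitesProj θ J * site a (vecMulVec θ.ofLp (star θ.ofLp)) := by
    rw [site, sitesProj, sitesProj, piTensor_mul]
    congr 1
    ext1 i
    rcases eq_or_ne i a with rfl | h <;> simp [*]
  rw [h, siteDefect, eq_sub_iff_add_eq, ← mul_add, site_add_site_one_sub, mul_one]

/-- The union bound for the projections onto `θ` on the sites in `J`. -/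
theorem one_sub_sum_le_trace_sitesProj_mul (hθ : ‖θ‖ = 1) {R : Matrix (ι → X) (ι → X) ℂ}
    (hR : IsDensity R) (J : Finset ι) :
    1 - ∑ i ∈ J, (siteDefect θ i * R).trace.re ≤ (sitesProj θ J * R).trace.re := by
  induction J using Finset.induction_on with
  | empty => simp [sitesProj, piTensor_one, hR.2]
  | insert a J ha ih =>
    have hc := (sitesProj_commute_siteDefect (θ := θ) ha).eq
    have hE := sitesProj_mul_self hθ J
    have hQ := siteDefect_mul_self hθ a
    have h := trace_mul_nonneg_of_isHermitian_of_idempotent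
      (P := siteDefect θ a - sitesProj θ J * siteDefect θ a) (R := R) ?_ ?_ hR.1
    · rw [sub_mul, trace_sub, Complex.sub_re] at h
      rw [Finset.sum_insert ha, sitesProj_insert ha, sub_mul, trace_sub, Complex.sub_re]
      linarith
    · refine (siteDefect_isHermitian θ a).sub ?_
      rw [IsHermitian, conjTranspose_mul, (sitesProj_isHermitian θ J).eq,
        (siteDefect_isHermitian θ a).eq, hc]
    · have e1 : siteDefect θ a * (sitesProj θ J * siteDefect θ a) =
          sitesProj θ J * siteDefect θ a := by rw [← mul_assoc, ← hc, mul_assoc, hQ]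
      have e2 : sitesProj θ J * siteDefect θ a * (sitesProj θ J * siteDefect θ a) =
          sitesProj θ J * siteDefect θ a := by rw [mul_assoc, e1, ← mul_assoc, hE]
      rw [sub_mul, mul_sub, mul_sub, hQ, e1, e2, mul_assoc, hQ]
      simp

theorem isSymmetricProjection_siteDefect (hθ : ‖θ‖ = 1) (i : ι) :
    (toEuclideanLin (siteDefect θ i)).IsSymmetricProjection where
  isSymmetric := isSymmetric_toEuclideanLin_iff.mpr (siteDefect_isHermitian θ i)
  isIdempotentElem := by
    rw [IsIdempotentElem, Module.End.mul_eq_comp, ← toLpLin_mul_same, siteDefect_mul_self hθ]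

theorem commute_siteDefect (i j : ι) : Commute (toEuclideanLin (siteDefect θ i))
    (toEuclideanLin (siteDefect θ j)) := by
  rw [Commute, SemiconjBy, Module.End.mul_eq_comp, Module.End.mul_eq_comp, ← toLpLin_mul_same,
    ← toLpLin_mul_same, siteDefect, siteDefect, (site_commute i j _).eq]

theorem toEuclideanLin_siteDefect_eq_zero (hθ : ‖θ‖ = 1) {i : ι} {ψ : EuclideanSpace ℂ (ι → X)}
    (g : (ι → X) → ℂ) (hψ : ∀ x a, ψ (Function.update x i a) = θ a * g x) :
    toEuclideanLin (siteDefect θ i) ψ = 0 := by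
  have h := inner_self_eq_norm_sq_to_K (𝕜 := ℂ) θ
  rw [EuclideanSpace.inner_eq_star_dotProduct, dotProduct_comm, hθ, dotProduct] at h
  ext x
  have e : ψ x = θ (x i) * g x := by rw [← hψ, Function.update_eq_self]
  change (siteDefect θ i *ᵥ ψ.ofLp) x = 0
  rw [siteDefect, site_mulVec_apply]
  simp only [hψ, Matrix.sub_apply, sub_mul, Finset.sum_sub_distrib, vecMulVec_apply, Pi.star_apply]
  have e2 : ∀ a, θ (x i) * star (θ a) * (θ a * g x) =
      θ (x i) * g x * (star (θ a) * θ a) := fun a => by ring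
  rw [Finset.sum_congr rfl fun a _ => e2 a, ← Finset.mul_sum,
    show ∑ a, star (θ a) * θ a = 1 by simpa using h]
  simp [one_apply]

end Projections

theorem trace_submatrix_equiv {Y Z : Type*} [Fintype Y] [Fintype Z] (M : Matrix Y Y ℂ)
    (e : Z ≃ Y) : (M.submatrix e e).trace = M.trace :=
  Equiv.sum_comp e fun x => M x x

section Main

variable {X : Type*} [Fintype X] [DecidableEq X] {θ : EuclideanSpace ℂ X} {n : ℕ}

theorem span_defectVectors_le (hθ : ‖θ‖ = 1) (r : ℕ) :
    Submodule.span ℂ (defectVectors (Nat.sub_le n r) θ) ≤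
      defectSpan (fun i : Fin n => toEuclideanLin (siteDefect θ i)) Finset.univ r := by
  refine Submodule.span_mono ?_
  rintro _ ⟨π, Ω, rfl⟩
  refine ⟨Finset.univ.map ((Fin.castLEEmb (Nat.sub_le n r)).trans π.toEmbedding),
    Finset.subset_univ _, by simp; omega, fun j hj => ?_⟩
  obtain ⟨i, rfl⟩ : ∃ i, π (Fin.castLE (Nat.sub_le n r) i) = j := by
    simpa using hj
  refine toEuclideanLin_siteDefect_eq_zero hθ (fun x =>
    (∏ k ∈ Finset.univ.erase i, θ (x (π (Fin.castLE (Nat.sub_le n r) k)))) *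
      Ω fun k => x (π (Fin.cast (Nat.add_sub_of_le (Nat.sub_le n r)) (Fin.natAdd (n - r) k))))
    fun x a => ?_
  have hne : ∀ k ∈ Finset.univ.erase i, Fin.castLE (Nat.sub_le n r) k ≠
      Fin.castLE (Nat.sub_le n r) i := fun k hk => by
    simpa [Fin.ext_iff] using Finset.ne_of_mem_erase hk
  have hne' : ∀ k, Fin.cast (Nat.add_sub_of_le (Nat.sub_le n r)) (Fin.natAdd (n - r) k) ≠
      Fin.castLE (Nat.sub_le n r) i := fun k hk => by
    have h := congrArg Fin.val hk
    simp at h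
    omega
  simp only [permVec, powTensor, Function.comp_apply]
  rw [← Finset.mul_prod_erase _ _ (Finset.mem_univ i), Function.update_self, mul_assoc]
  congr 2
  · refine Finset.prod_congr rfl fun k hk => ?_
    rw [Function.update_of_ne (π.injective.ne (hne k hk))]
  · refine congrArg Ω.ofLp (funext fun k => ?_)
    rw [Function.update_of_ne (π.injective.ne (hne' k))]

theorem sum_trace_siteDefect_mul_le (hθ : ‖θ‖ = 1) {r : ℕ}
    {R : Matrix (Fin n → X) (Fin n → X) ℂ} (hR : IsDensity R)
    (hsupp : supp R ≤ Submodule.span ℂ (defectVectors (Nat.sub_le n r) θ)) :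
    ∑ i, (siteDefect θ i * R).trace.re ≤ (r : ℝ) := by
  obtain ⟨b, hbs, hb⟩ := PosSemidef.exists_ensemble hR.1
  have hQ : ∀ i k, ⟪b k, toEuclideanLin (siteDefect θ i) (b k)⟫_ℂ =
      ((‖toEuclideanLin (siteDefect θ i) (b k)‖ ^ 2 : ℝ) : ℂ) := by
    intro i k
    have hP := isSymmetricProjection_siteDefect hθ i
    have h : toEuclideanLin (siteDefect θ i) (toEuclideanLin (siteDefect θ i) (b k)) =
      toEuclideanLin (siteDefect θ i) (b k) := LinearMap.congr_fun hP.isIdempotentElem (b k)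
    rw [← h, ← hP.isSymmetric, inner_self_eq_norm_sq_to_K, h]
    norm_cast
  have h1 : ∑ k, ‖b k‖ ^ 2 = 1 := hR.sum_norm_sq_eq_one hb
  calc ∑ i, (siteDefect θ i * R).trace.re
      = ∑ k, ∑ i, ‖toEuclideanLin (siteDefect θ i) (b k)‖ ^ 2 := by
        rw [Finset.sum_comm]
        refine Finset.sum_congr rfl fun i _ => ?_
        simp only [hb, hQ, ← Complex.ofReal_sum, Complex.ofReal_re]
    _ ≤ ∑ k, (r : ℝ) * ‖b k‖ ^ 2 := Finset.sum_le_sum fun k _ =>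
        sum_norm_sq_apply_le_of_mem_defectSpan commute_siteDefect
          (isSymmetricProjection_siteDefect hθ) _ r _
          (span_defectVectors_le hθ r (hsupp (hbs k)))
    _ = r := by rw [← Finset.mul_sum, h1, mul_one]

theorem IsPermInvariant.trace_siteDefect_mul_eq {R : Matrix (Fin n → X) (Fin n → X) ℂ}
    (hR : IsPermInvariant R) (i j : Fin n) :
    (siteDefect θ i * R).trace = (siteDefect θ j * R).trace := by
  set π := Equiv.swap i j
  have h1 : (siteDefect θ i).submatrix (fun x => x ∘ π) (fun x => x ∘ π) = siteDefect θ j := by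
    rw [siteDefect, site, piTensor_submatrix_comp, siteDefect, site, Equiv.symm_swap]
    congr 1
    ext1 k
    simp only [Function.comp_apply, Function.update_apply]
    congr 1
    rw [Equiv.swap_apply_eq_iff, Equiv.swap_apply_left]
  rw [← h1]
  conv_rhs => rw [← hR π]
  let e : (Fin n → X) ≃ (Fin n → X) := π.symm.arrowCongr (Equiv.refl X)
  rw [show (fun x : Fin n → X => x ∘ π) = e from rfl, submatrix_mul_equiv]
  exact (trace_submatrix_equiv _ e).symm

omit [Fintype X] in
theorem sitesProj_join {s : ℕ} (h : s ≤ n) (x y : Fin s → X) (z w : Fin (n - s) → X) :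
    sitesProj θ (Finset.univ.map (Fin.castLEEmb h)) (join h x z) (join h y w) =
      if z = w then vecPow θ s x * star (vecPow θ s y) else 0 := by
  have hmem : ∀ j : Fin (n - s), Fin.cast (Nat.add_sub_of_le h) (Fin.natAdd s j) ∉
      Finset.univ.map (Fin.castLEEmb h) := by
    intro j hj
    obtain ⟨i, -, hi⟩ := Finset.mem_map.mp hj
    have h := congrArg Fin.val hi
    simp at h
    omega
  have hmem' : ∀ i : Fin s, Fin.castLE h i ∈ Finset.univ.map (Fin.castLEEmb h) := fun i =>
    Finset.mem_map_of_mem (Fin.castLEEmb h) (Finset.mem_univ i)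
  rw [sitesProj, piTensor, of_apply, prod_eq_prod_castLE_mul_prod_natAdd h]
  simp only [hmem, hmem', if_true, if_false, join_castLE, join_natAdd, vecMulVec_apply, one_apply,
    Finset.prod_ite_zero, Finset.prod_mul_distrib, Pi.star_apply, vecPow, star_prod]
  simp [funext_iff]

theorem trace_sitesProj_mul_eq {s : ℕ} (h : s ≤ n) (R : Matrix (Fin n → X) (Fin n → X) ℂ) :
    (sitesProj θ (Finset.univ.map (Fin.castLEEmb h)) * R).trace =
      (vecMulVec (vecPow θ s).ofLp (star (vecPow θ s).ofLp) * trLast h R).trace := by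
  simp only [trace, diag, mul_apply, sum_eq_sum_join h, sitesProj_join, ite_mul, zero_mul,
    Finset.sum_ite_eq, Finset.mem_univ, if_true, trLast, of_apply, Finset.mul_sum,
    vecMulVec_apply, Pi.star_apply]
  exact Finset.sum_congr rfl fun x _ => Finset.sum_comm

end Main

end AlmostIID

theorem mainTheorem4 {A : Type*} [Fintype A] [DecidableEq A] (n r s : ℕ) (hn : 1 ≤ n)
    (hr : r ≤ n) (hs : s ≤ n) (σ : Matrix A A ℂ) (hσ : AlmostIID.IsDensity σ)
    (ρ : Matrix (Fin n → A) (Fin n → A) ℂ) (hρ : AlmostIID.IsAlmostIID r σ ρ) :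
    AlmostIID.traceNorm (AlmostIID.trLast hs ρ - AlmostIID.tensorPow σ s) ≤
      4 * Real.sqrt ((r : ℝ) * (s : ℝ) / (n : ℝ)) := by
  open AlmostIID Matrix in
  obtain ⟨-, d, θ, R, hθσ, hR, rfl, hperm, hsupp⟩ := hρ
  have hθ : ‖θ‖ = 1 := hθσ.norm_eq_one hσ
  have hn0 : (0 : ℝ) < n := by exact_mod_cast hn
  let i₀ : Fin n := ⟨0, hn⟩
  have hsite : ∀ i, (siteDefect θ i * R).trace.re = (siteDefect θ i₀ * R).trace.re := fun i => by
    rw [hperm.trace_siteDefect_mul_eq i i₀]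
  have hq : (siteDefect θ i₀ * R).trace.re ≤ r / n := by
    have h := sum_trace_siteDefect_mul_le hθ hR hsupp
    simp only [hsite, Finset.sum_const, Finset.card_univ, Fintype.card_fin, nsmul_eq_mul] at h
    rw [le_div_iff₀ hn0]
    linarith
  have hF : 1 - (r : ℝ) * s / n ≤
      (vecMulVec (vecPow θ s).ofLp (star (vecPow θ s).ofLp) * trLast hs R).trace.re := by
    rw [← trace_sitesProj_mul_eq]
    refine le_trans ?_ (one_sub_sum_le_trace_sitesProj_mul hθ hR _)
    simp only [hsite, Finset.sum_const, Finset.card_map, Finset.card_univ, Fintype.card_fin,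
      nsmul_eq_mul]
    have := mul_le_mul_of_nonneg_left hq (Nat.cast_nonneg (α := ℝ) s)
    have e : (r : ℝ) * s / n = s * (r / n) := by ring
    linarith
  let e := pairEquiv A (Fin d) s
  have hD := hR.trLast hs
  have key := traceNorm_trE_sub_le (D := (trLast hs R).submatrix e e)
    (Θ := WithLp.toLp 2 ((vecPow θ s).ofLp ∘ e)) (δ := (r : ℝ) * s / n) ?_ ?_ ?_
  · rw [trLast_trEs, tensorPow_eq_trE hθσ]
    have h4 : 3 * √((r : ℝ) * s / n) ≤ 4 * √((r : ℝ) * s / n) :=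
      mul_le_mul_of_nonneg_right (by norm_num) (Real.sqrt_nonneg _)
    refine le_trans (le_of_eq ?_) (key.trans h4)
    congr 1
    ext x y
    simp [trE, vecMulVec_apply, e]
  · exact ⟨hD.1.submatrix _, by rw [trace_submatrix_equiv, hD.2]⟩
  · rw [← norm_vecPow (s := s) hθ, EuclideanSpace.norm_eq, EuclideanSpace.norm_eq]
    congr 1
    exact Equiv.sum_comp e fun x => ‖vecPow θ s x‖ ^ 2
  · refine hF.trans_eq ?_
    congr 1
    rw [show vecMulVec ((vecPow θ s).ofLp ∘ e) (star ((vecPow θ s).ofLp ∘ e)) =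
      (vecMulVec (vecPow θ s).ofLp (star (vecPow θ s).ofLp)).submatrix e e from rfl,
      submatrix_mul_equiv, trace_submatrix_equiv]
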